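/- For real $t$ let $\{t\}_2\in\,]-1,1]$ denote the unique number with $t-\{t\}_2\in 2\mathbb Z$. For $0<\beta\le 1$ define $U_\beta(0)=0$ and $U_\beta(x)=\{-\beta/x\}_2$ for $x\ne 0$, and let $\mathbf C_\beta:L^\infty(]-1,1])\to L^\infty(]-1,1])$ (complex-valued functions, Lebesgue measure) be the operator $$\mathbf C_\beta[f](x)=f(U_\beta(x))\,1_{]-\beta,\beta]}(x).$$ Let $\mathbf C_\beta^*:L^1(]-1,1])\to L^1(]-1,1])$ be its predual adjoint, i.e. the unique bounded linear operator with $$\int_{]-1,1]} f(x)\,\mathbf C_\beta^*[g](x)\,dx=\int_{]-1,1]}\mathbf C_\beta[f](x)\,g(x)\,dx\qquad\text{for all } g\in L^1(]-1,1]),\ f\in L^\infty(]-1,1]).$$ Then, for every $0<\beta\le1$, the point spectrum (set of eigenvalues) $\sigma_p(\mathbf C_\beta^*)$ is contained in the open unit disk $\{\lambda\in\mathbb C:|\lambda|<1\}$. In particular, $1$ and $-1$ are not eigenvalues of $\mathbf C_\beta^*$. -/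

import Mathlib

open MeasureTheory Set
open scoped ENNReal

noncomputable section

namespace GaussType

/-- Lebesgue measure on the interval `]-1,1]`. -/
def leb : Measure ℝ := volume.restrict (Ioc (-1) 1)

instance : IsFiniteMeasure leb := by unfold leb; infer_instance

/-- The complex space `L^∞(]-1,1])`. -/
abbrev LInf : Type := Lp ℂ ∞ leb

/-- The complex space `L^1(]-1,1])`. -/
abbrev LOne : Type := Lp ℂ 1 leb

/-- `{t}₂`, the unique number in `]-1,1]` with `t - {t}₂ ∈ 2ℤ`. -/
def mod2 (t : ℝ) : ℝ := toIocMod (two_pos : (0 : ℝ) < 2) (-1) t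

/-- The Gauss-type map `U_β(x) = {-β/x}₂` for `x ≠ 0`, and `U_β(0) = 0`. -/
def U (β x : ℝ) : ℝ := if x = 0 then 0 else mod2 (-β / x)

theorem mod2_mem (t : ℝ) : mod2 t ∈ Ioc (-1 : ℝ) 1 := by
  have h := toIocMod_mem_Ioc (two_pos : (0 : ℝ) < 2) (-1) t
  have e : (-1 : ℝ) + 2 = 1 := by norm_num
  rwa [e] at h

theorem measurable_mod2 : Measurable mod2 := by
  have : mod2 = fun t : ℝ => t - ((-⌊((-1 : ℝ) + 2 - t) / 2⌋ : ℤ) : ℝ) * 2 := by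
    funext t
    rw [mod2, toIocMod, toIocDiv_eq_neg_floor, zsmul_eq_mul]
  rw [this]
  have h : Measurable fun t : ℝ => ⌊((-1 : ℝ) + 2 - t) / 2⌋ :=
    Int.measurable_floor.comp (by fun_prop)
  have h2 : Measurable fun t : ℝ => ((-⌊((-1 : ℝ) + 2 - t) / 2⌋ : ℤ) : ℝ) :=
    (measurable_from_top (f := fun n : ℤ => ((-n : ℤ) : ℝ))).comp h
  fun_prop

theorem measurable_U (β : ℝ) : Measurable (U β) := by
  unfold U
  refine Measurable.ite (measurableSet_singleton 0) measurable_const ?_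
  exact measurable_mod2.comp (by fun_prop)

/-- `U_β` pulls null sets back to null sets, so that `f ∘ U_β` makes sense on `]-β,β]` for
classes of functions modulo null sets. -/
theorem quasi_U (β : ℝ) :
    Measure.QuasiMeasurePreserving (U β) (volume.restrict (Ioc (-β) β)) leb := by
  refine ⟨measurable_U β, ?_⟩
  rcases le_or_gt β 0 with hβ | hβ
  · have : Ioc (-β) β = ∅ := Ioc_eq_empty (by linarith)
    rw [this, Measure.restrict_empty, Measure.map_zero]
    exact Measure.AbsolutelyContinuous.zero _
  refine Measure.AbsolutelyContinuous.mk fun s hs h0 => ?_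
  rw [Measure.map_apply (measurable_U β) hs]
  refine le_antisymm ((Measure.restrict_apply_le _ _).trans ?_) bot_le
  rw [leb, Measure.restrict_apply hs] at h0
  set N : Set ℝ := ⋃ n : ℤ, (fun x => x + n * 2) '' (s ∩ Ioc (-1) 1) with hN
  have hN0 : volume N = 0 := by
    refine measure_iUnion_null fun n => ?_
    rw [image_add_right, measure_preimage_add_right, h0]
  have hsub : U β ⁻¹' s ⊆ {0} ∪ (fun y : ℝ => -β / y) '' (N ∩ {0}ᶜ) := by
    intro x hx
    by_cases hx0 : x = 0
    · exact Or.inl hx0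
    right
    have hx' : mod2 (-β / x) ∈ s := by
      have : U β x ∈ s := hx
      rwa [U, if_neg hx0] at this
    refine ⟨-β / x, ⟨mem_iUnion.2 ⟨toIocDiv (two_pos : (0 : ℝ) < 2) (-1) (-β / x),
      mod2 (-β / x), ⟨hx', mod2_mem _⟩, ?_⟩, ?_⟩, ?_⟩
    · have := toIocMod_add_toIocDiv_zsmul (two_pos : (0 : ℝ) < 2) (-1) (-β / x)
      rw [zsmul_eq_mul] at this
      exact this
    · exact div_ne_zero (by linarith) hx0
    · have : β ≠ 0 := hβ.ne'
      simp only
      field_simp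
  have himg : volume ((fun y : ℝ => -β / y) '' (N ∩ {0}ᶜ)) = 0 := by
    refine addHaar_image_eq_zero_of_differentiableOn_of_addHaar_eq_zero volume ?_
      (measure_mono_null inter_subset_left hN0)
    intro y hy
    have hy0 : y ≠ 0 := hy.2
    exact ((differentiableAt_const _).div differentiableAt_id hy0).differentiableWithinAt
  exact (measure_mono_null hsub (measure_union_null (by simp) himg)).le

theorem quasi_U' (β : ℝ) :
    Measure.QuasiMeasurePreserving (U β) (leb.restrict (Ioc (-β) β)) leb := by
  refine (quasi_U β).mono_left (Measure.absolutelyContinuous_of_le ?_)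
  exact Measure.restrict_mono_measure Measure.restrict_le_self _

/-- The function `x ↦ f(U_β(x)) 1_{]-β,β]}(x)`. -/
def compFun (β : ℝ) (f : ℝ → ℂ) : ℝ → ℂ := (Ioc (-β) β).indicator fun x => f (U β x)

theorem ae_norm_le (f : LInf) : ∀ᵐ x ∂leb, ‖f x‖ ≤ ‖f‖ := by
  have h : ∀ᵐ x ∂leb, ‖f x‖ₑ ≤ eLpNorm f ∞ leb := ae_le_eLpNormEssSup
  filter_upwards [h] with x hx
  rw [Lp.norm_def, ← toReal_enorm]
  exact ENNReal.toReal_mono (Lp.eLpNorm_ne_top f) hx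

/-- Transfer of an almost everywhere statement along the map. -/
theorem ae_comp {p : ℝ → Prop} (β : ℝ) (h : ∀ᵐ x ∂leb, p x) :
    ∀ᵐ x ∂leb, x ∈ Ioc (-β) β → p (U β x) :=
  (ae_restrict_iff' measurableSet_Ioc).1 ((quasi_U' β).ae h)

theorem compFun_aesm (β : ℝ) (f : LInf) : AEStronglyMeasurable (compFun β f) leb := by
  rw [compFun, aestronglyMeasurable_indicator_iff measurableSet_Ioc]
  exact (Lp.aestronglyMeasurable f).comp_quasiMeasurePreserving (quasi_U' β)

theorem compFun_bound (β : ℝ) (f : LInf) : ∀ᵐ x ∂leb, ‖compFun β f x‖ ≤ ‖f‖ := by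
  filter_upwards [ae_comp β (ae_norm_le f)] with x hx
  by_cases hm : x ∈ Ioc (-β) β
  · rw [compFun, indicator_of_mem hm]; exact hx hm
  · rw [compFun, indicator_of_notMem hm]; simp

theorem compFun_memLp (β : ℝ) (f : LInf) : MemLp (compFun β f) ∞ leb :=
  memLp_top_of_bound (compFun_aesm β f) ‖f‖ (compFun_bound β f)

/-- The compressed composition operator `C_β[f](x) = f(U_β(x)) 1_{]-β,β]}(x)` on
`L^∞(]-1,1])`. -/
def C (β : ℝ) : LInf →L[ℂ] LInf :=
  LinearMap.mkContinuous
    { toFun := fun f => (compFun_memLp β f).toLp (compFun β f)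
      map_add' := by
        intro f g
        rw [← MemLp.toLp_add, MemLp.toLp_eq_toLp_iff]
        filter_upwards [ae_comp β (Lp.coeFn_add f g)] with x hx
        by_cases hm : x ∈ Ioc (-β) β
        · simpa [compFun, hm] using hx hm
        · simp [compFun, hm]
      map_smul' := by
        intro c f
        rw [RingHom.id_apply, ← MemLp.toLp_const_smul, MemLp.toLp_eq_toLp_iff]
        filter_upwards [ae_comp β (Lp.coeFn_smul c f)] with x hx
        by_cases hm : x ∈ Ioc (-β) β
        · simpa [compFun, hm] using hx hm
        · simp [compFun, hm] }
    1 (by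
      intro f
      rw [one_mul, LinearMap.coe_mk, AddHom.coe_mk, Lp.norm_toLp]
      refine ENNReal.toReal_le_of_le_ofReal (norm_nonneg _) ?_
      exact eLpNormEssSup_le_of_ae_bound (compFun_bound β f))

/-- The bilinear pairing `⟨g, f⟩ = ∫_{]-1,1]} f(x) g(x) dx` of `L^1` with `L^∞`. -/
def pairing (g : LOne) (f : LInf) : ℂ := ∫ x, f x * g x ∂leb

/-- `T` is the predual adjoint of `A`: `⟨T g, f⟩ = ⟨g, A f⟩` for all `g ∈ L^1`, `f ∈ L^∞`. -/
def IsPredualAdjoint (A : LInf →L[ℂ] LInf) (T : LOne →L[ℂ] LOne) : Prop :=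
  ∀ (g : LOne) (f : LInf), pairing (T g) f = pairing g (A f)

theorem C_coeFn (β : ℝ) (f : LInf) : C β f =ᵐ[leb] compFun β f :=
  MemLp.coeFn_toLp (compFun_memLp β f)

theorem C_norm_le (β : ℝ) (f : LInf) : ‖C β f‖ ≤ ‖f‖ := by
  have h := (C β).le_of_opNorm_le (LinearMap.mkContinuous_norm_le _ zero_le_one _) f
  rwa [one_mul] at h

theorem integrable_mul (f : LInf) {g : ℝ → ℂ} (hg : Integrable g leb) :
    Integrable (fun x => f x * g x) leb :=
  hg.bdd_mul (Lp.aestronglyMeasurable f) (ae_norm_le f)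

theorem integrable_coe (g : LOne) : Integrable g leb := L1.integrable_coeFn g

theorem pairing_add (g h : LOne) (f : LInf) :
    pairing (g + h) f = pairing g f + pairing h f := by
  unfold pairing
  rw [← integral_add (integrable_mul f (integrable_coe g)) (integrable_mul f (integrable_coe h))]
  refine integral_congr_ae ?_
  filter_upwards [Lp.coeFn_add g h] with x hx
  rw [hx, Pi.add_apply, mul_add]

theorem pairing_smul (c : ℂ) (g : LOne) (f : LInf) :
    pairing (c • g) f = c * pairing g f := by
  unfold pairing
  rw [← integral_const_mul]
  refine integral_congr_ae ?_
  filter_upwards [Lp.coeFn_smul c g] with x hx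
  rw [hx, Pi.smul_apply, smul_eq_mul]
  ring

theorem pairing_norm_le (g : LOne) (f : LInf) : ‖pairing g f‖ ≤ ‖f‖ * ‖g‖ := by
  unfold pairing
  rw [L1.norm_eq_integral_norm, ← integral_const_mul]
  refine norm_integral_le_of_norm_le ((integrable_coe g).norm.const_mul _) ?_
  filter_upwards [ae_norm_le f] with x hx
  rw [norm_mul]
  gcongr

/-- The pairing is norming on `L^1`. -/
theorem exists_norming (g : LOne) : ∃ f : LInf, ‖f‖ ≤ 1 ∧ pairing g f = ‖g‖ := by
  set s : ℝ → ℂ := fun x => (starRingEnd ℂ) (g x) / ‖g x‖ with hs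
  have hm : AEStronglyMeasurable s leb := by
    have h1 : AEMeasurable (g : ℝ → ℂ) leb := (Lp.aestronglyMeasurable g).aemeasurable
    have h2 : AEMeasurable (fun x => (starRingEnd ℂ) (g x)) leb :=
      Complex.continuous_conj.measurable.comp_aemeasurable h1
    have h3 : AEMeasurable (fun x => ((‖g x‖ : ℝ) : ℂ)) leb :=
      Complex.measurable_ofReal.comp_aemeasurable h1.norm
    exact (h2.div h3).aestronglyMeasurable
  have hb : ∀ᵐ x ∂leb, ‖s x‖ ≤ 1 := by
    refine Filter.Eventually.of_forall fun x => ?_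
    simp only [hs, norm_div, RCLike.norm_conj, Complex.norm_real, norm_norm]
    exact div_self_le_one _
  have hL : MemLp s ∞ leb := memLp_top_of_bound hm 1 hb
  refine ⟨hL.toLp s, ?_, ?_⟩
  · rw [Lp.norm_toLp]
    refine ENNReal.toReal_le_of_le_ofReal zero_le_one ?_
    exact eLpNormEssSup_le_of_ae_bound hb
  · unfold pairing
    rw [L1.norm_eq_integral_norm, ← integral_complex_ofReal]
    refine integral_congr_ae ?_
    filter_upwards [hL.coeFn_toLp] with x hx
    rw [hx]
    by_cases h0 : g x = 0
    · simp [hs, h0]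
    · have hn : ((‖g x‖ : ℝ) : ℂ) ≠ 0 := by simpa using h0
      simp only [hs]
      rw [div_mul_eq_mul_div, div_eq_iff hn, Complex.conj_mul', sq]

theorem pairing_ext {g h : LOne} (H : ∀ f, pairing g f = pairing h f) : g = h := by
  obtain ⟨f, -, hf⟩ := exists_norming (g + (-1 : ℂ) • h)
  rw [pairing_add, pairing_smul, H f] at hf
  have h0 : ((‖g + (-1 : ℂ) • h‖ : ℝ) : ℂ) = 0 := by rw [← hf]; ring
  rw [Complex.ofReal_eq_zero, norm_eq_zero, neg_one_smul, ← sub_eq_add_neg] at h0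
  exact sub_eq_zero.1 h0

theorem integrable_ofReal {g : ℝ → ℝ} (hg : Integrable g leb) :
    Integrable (fun x => (g x : ℂ)) leb := hg.ofReal

/-- Solvability of the adjoint equation, for a nonnegative density. -/
theorem exists_adj_nonneg (β : ℝ) (g : ℝ → ℝ) (hg : Integrable g leb) (h0 : ∀ x, 0 ≤ g x) :
    ∃ h : ℝ → ℂ, Integrable h leb ∧
      ∀ f : LInf, ∫ x, f x * h x ∂leb = ∫ x, C β f x * (g x : ℂ) ∂leb := by
  set B := Ioc (-β) β
  set d : ℝ → ℝ≥0∞ := fun x => ENNReal.ofReal (g x) with hd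
  have hdm : AEMeasurable d (leb.restrict B) := hg.aemeasurable.ennreal_ofReal.restrict
  have hfin : ∫⁻ x, d x ∂(leb.restrict B) ≠ ∞ := (hg.restrict).lintegral_lt_top.ne
  set κ : Measure ℝ := (leb.restrict B).withDensity d with hκ
  have : IsFiniteMeasure κ := isFiniteMeasure_withDensity hfin
  set ν : Measure ℝ := κ.map (U β) with hν
  have hac : ν ≪ leb :=
    ((withDensity_absolutelyContinuous _ _).map (measurable_U β)).trans
      (quasi_U' β).absolutelyContinuous
  refine ⟨fun x => ((ν.rnDeriv leb x).toReal : ℂ), ?_, fun f => ?_⟩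
  · exact Measure.integrable_toReal_rnDeriv.ofReal
  · have e1 : ∫ x, f x * ((ν.rnDeriv leb x).toReal : ℂ) ∂leb = ∫ x, f x ∂ν := by
      rw [← integral_rnDeriv_smul hac]
      refine integral_congr_ae (Filter.Eventually.of_forall fun x => ?_)
      simp [mul_comm]
    have e2 : ∫ x, f x ∂ν = ∫ x, f (U β x) ∂κ :=
      integral_map (measurable_U β).aemeasurable ((Lp.aestronglyMeasurable f).mono_ac hac)
    have e3 : ∫ x, f (U β x) ∂κ = ∫ x in B, (d x).toReal • f (U β x) ∂leb :=
      integral_withDensity_eq_integral_toReal_smul₀ hdm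
        (Filter.Eventually.of_forall fun x => ENNReal.ofReal_lt_top) _
    rw [e1, e2, e3, ← integral_indicator measurableSet_Ioc]
    refine integral_congr_ae ?_
    filter_upwards [C_coeFn β f] with x hx
    rw [hx, compFun]
    by_cases hm : x ∈ B
    · rw [indicator_of_mem hm, indicator_of_mem hm, hd]
      simp only [ENNReal.toReal_ofReal (h0 x), Complex.real_smul]
      ring
    · rw [indicator_of_notMem hm, indicator_of_notMem hm, zero_mul]

theorem exists_adj_real (β : ℝ) (g : ℝ → ℝ) (hg : Integrable g leb) :
    ∃ h : ℝ → ℂ, Integrable h leb ∧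
      ∀ f : LInf, ∫ x, f x * h x ∂leb = ∫ x, C β f x * (g x : ℂ) ∂leb := by
  obtain ⟨h₁, i₁, e₁⟩ := exists_adj_nonneg β (fun x => max (g x) 0) hg.pos_part
    fun x => le_max_right _ _
  obtain ⟨h₂, i₂, e₂⟩ := exists_adj_nonneg β (fun x => max (-g x) 0) hg.neg_part
    fun x => le_max_right _ _
  refine ⟨fun x => h₁ x - h₂ x, i₁.sub i₂, fun f => ?_⟩
  simp only [mul_sub]
  rw [integral_sub (integrable_mul f i₁) (integrable_mul f i₂), e₁, e₂,
    ← integral_sub (integrable_mul _ (integrable_ofReal hg.pos_part))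
      (integrable_mul _ (integrable_ofReal hg.neg_part))]
  refine integral_congr_ae (Filter.Eventually.of_forall fun x => ?_)
  simp only [← mul_sub, ← Complex.ofReal_sub]
  congr 2
  rcases le_total (g x) 0 with h | h
  · rw [max_eq_right h, max_eq_left (by linarith)]; ring
  · rw [max_eq_left h, max_eq_right (by linarith)]; ring

theorem exists_adj (β : ℝ) (g : LOne) :
    ∃ h : LOne, ∀ f : LInf, pairing h f = pairing g (C β f) := by
  have ir := (integrable_coe g).re
  have ii := (integrable_coe g).im
  obtain ⟨h₁, i₁, e₁⟩ := exists_adj_real β _ ir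
  obtain ⟨h₂, i₂, e₂⟩ := exists_adj_real β _ ii
  have i₃ : Integrable (fun x => h₁ x + Complex.I * h₂ x) leb := i₁.add (i₂.const_mul _)
  refine ⟨i₃.toL1 _, fun f => ?_⟩
  have l : pairing (i₃.toL1 _) f = ∫ x, f x * (h₁ x + Complex.I * h₂ x) ∂leb := by
    refine integral_congr_ae ?_
    filter_upwards [i₃.coeFn_toL1] with x hx
    rw [hx]
  have r : pairing g (C β f) = (∫ x, C β f x * ((RCLike.re (g x) : ℝ) : ℂ) ∂leb)
      + Complex.I * ∫ x, C β f x * ((RCLike.im (g x) : ℝ) : ℂ) ∂leb := by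
    rw [← integral_const_mul, ← integral_add (integrable_mul _ (integrable_ofReal ir))
      ((integrable_mul _ (integrable_ofReal ii)).const_mul _)]
    refine integral_congr_ae (Filter.Eventually.of_forall fun x => ?_)
    have := Complex.re_add_im (g x)
    simp only [RCLike.re_to_complex, RCLike.im_to_complex]
    linear_combination (-(C β f x)) * this
  rw [l, r, ← e₁, ← e₂, ← integral_const_mul,
    ← integral_add (integrable_mul _ i₁) ((integrable_mul _ i₂).const_mul _)]
  refine integral_congr_ae (Filter.Eventually.of_forall fun x => ?_)
  simp only
  ring

theorem existsUnique_predualAdjoint (β : ℝ) : ∃! T, IsPredualAdjoint (C β) T := by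
  choose T hT using exists_adj β
  let L : LOne →ₗ[ℂ] LOne :=
    { toFun := T
      map_add' := fun g h => pairing_ext fun f => by
        rw [hT, pairing_add, pairing_add, hT, hT]
      map_smul' := fun c g => pairing_ext fun f => by
        rw [RingHom.id_apply, hT, pairing_smul, pairing_smul, hT] }
  refine ⟨L.mkContinuous 1 fun g => ?_, fun g f => hT g f, fun S hS => ?_⟩
  · obtain ⟨f, hf, e⟩ := exists_norming (T g)
    have e' : ‖T g‖ = ‖pairing g (C β f)‖ := by
      rw [← hT, e, Complex.norm_real, norm_norm]
    change ‖T g‖ ≤ 1 * ‖g‖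
    rw [e']
    refine (pairing_norm_le _ _).trans ?_
    gcongr
    exact (C_norm_le β f).trans hf
  · refine ContinuousLinearMap.ext fun g => pairing_ext fun f => ?_
    exact (hS g f).trans (hT g f).symm

/-- The predual adjoint `C_β^* : L^1(]-1,1]) → L^1(]-1,1])` of `C_β`, that is, the unique
bounded operator with `⟨C_β^* g, f⟩ = ⟨g, C_β f⟩` for all `g ∈ L^1`, `f ∈ L^∞`. -/
def Cstar (β : ℝ) : LOne →L[ℂ] LOne := (existsUnique_predualAdjoint β).choose

theorem Cstar_spec (β : ℝ) : IsPredualAdjoint (C β) (Cstar β) :=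
  (existsUnique_predualAdjoint β).choose_spec.1

/-- The point spectrum: the set of eigenvalues. -/
def pointSpectrum (T : LOne →L[ℂ] LOne) : Set ℂ :=
  {z | Module.End.HasEigenvalue (T : LOne →ₗ[ℂ] LOne) z}

end GaussType

end

/-! Suppose `Cstar β g = z • g` with `1 ≤ ‖z‖`. Testing against the conjugate phase of `g` cut off
to a set `S` shows that the mass of `|g|` on `S` is at most its mass on the preimage `survivors β S`
(`setLIntegral_le_survivors`), hence at most its mass on every iterated preimage. If these preimages
get arbitrarily small in measure, absolute continuity of the integral kills `g` on `S`; this is done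
for every compact `S` in the open interval (`exists_volume_survivors_lt`).

The measure of the `n`-th preimage of `S` is the integral over `S` of `dens β n`, the `n`-th iterate
of the transfer operator on the constant 1 (`setLIntegral_dens`). It suffices that the Cesàro means
of these densities tend to 0 pointwise (`tendsto_mean`), with `weight` as dominating function. Any
limit point is a fixed density of finite mass. For `β = 1` the invariant density is `weight`, of
infinite mass; for `β < 1` it is strictly decreased. A maximum principle for the quotient by
`weight` then forces the limit to vanish (`Good.eq_zero_of_transfer_eq`). The regularity needed
throughout comes from the cone `Good`, whose Harnack bounds survive both the transfer operator and
pointwise limits. -/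

noncomputable section

namespace GaussType

open Filter Topology

/-! ### Inverse branches and the invariant weight. -/

/-- Nonzero integers, which index the inverse branches of the Gauss-type map. -/
abbrev NZ : Type := {j : ℤ // j ≠ 0}

/-- The inverse branch of `U β` with index `j`. -/
def branch (β : ℝ) (j : NZ) (x : ℝ) : ℝ := -β / (x + 2 * (j : ℤ))

/-- The contribution of the branch `j` to the transfer operator. -/
def term (β : ℝ) (f : ℝ → ℝ) (x : ℝ) (j : NZ) : ℝ :=
  β / (x + 2 * (j : ℤ)) ^ 2 * f (branch β j x)

/-- The transfer operator of `U β`, acting pointwise on functions. -/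
def transfer (β : ℝ) (f : ℝ → ℝ) (x : ℝ) : ℝ := ∑' j : NZ, term β f x j

/-- The density `1 / (1 - x²)`, invariant under the transfer operator for `β = 1`. -/
def weight (x : ℝ) : ℝ := (1 - x ^ 2)⁻¹

theorem one_sub_sq_pos {x : ℝ} (hx : x ∈ Ioo (-1 : ℝ) 1) : 0 < 1 - x ^ 2 := by
  nlinarith [hx.1, hx.2]

theorem one_le_weight {x : ℝ} (hx : x ∈ Ioo (-1 : ℝ) 1) : 1 ≤ weight x :=
  (one_le_inv₀ (one_sub_sq_pos hx)).2 (by nlinarith [sq_nonneg x])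

theorem NZ.one_le_or (j : NZ) : (1 : ℝ) ≤ (j : ℤ) ∨ ((j : ℤ) : ℝ) ≤ -1 := by
  rcases lt_or_gt_of_ne j.2 with h | h
  · right; exact_mod_cast (by omega : (j : ℤ) ≤ -1)
  · left; exact_mod_cast (by omega : (1 : ℤ) ≤ j)

theorem one_lt_or_lt_neg_one {x : ℝ} (hx : x ∈ Ioo (-1 : ℝ) 1) (j : NZ) :
    1 < x + 2 * (j : ℤ) ∨ x + 2 * (j : ℤ) < -1 := by
  rcases j.one_le_or with h | h
  · left; linarith [hx.1]
  · right; linarith [hx.2]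

theorem one_lt_sq {x : ℝ} (hx : x ∈ Ioo (-1 : ℝ) 1) (j : NZ) :
    1 < (x + 2 * (j : ℤ)) ^ 2 := by
  rcases one_lt_or_lt_neg_one hx j with h | h <;> nlinarith

theorem branch_mem {β : ℝ} (hβ₀ : 0 < β) (hβ₁ : β ≤ 1) {x : ℝ} (hx : x ∈ Ioo (-1 : ℝ) 1)
    (j : NZ) : branch β j x ∈ Ioo (-1 : ℝ) 1 := by
  have h := one_lt_sq hx j
  have h2 : (branch β j x) ^ 2 < 1 := by
    rw [branch, div_pow, div_lt_one (by linarith)]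
    nlinarith
  exact abs_lt.1 ((sq_lt_one_iff_abs_lt_one _).1 h2)

/-- The sum of a telescoping series with positive decreasing terms. -/
theorem hasSum_telescope {c : ℝ} (hc : 0 < c) :
    HasSum (fun n : ℕ => 1 / ((c + 1 + 2 * n) ^ 2 - 1)) (1 / (2 * c)) := by
  rw [hasSum_iff_tendsto_nat_of_nonneg]
  -- The denominator factors as `(c + 2i)(c + 2i + 2)`, so partial fractions telescope.
  · have e : ∀ n : ℕ, ∑ i ∈ Finset.range n, 1 / ((c + 1 + 2 * i) ^ 2 - 1)
        = 1 / (2 * c) - 1 / (2 * c + 4 * n) := by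
      intro n
      induction n with
      | zero => simp
      | succ n ih =>
        rw [Finset.sum_range_succ, ih]
        have hn : (0 : ℝ) ≤ n := n.cast_nonneg
        have e2 : (c + 1 + 2 * (n : ℝ)) ^ 2 - 1 = (c + 2 * n) * (c + 2 * n + 2) := by ring
        have e3 : 2 * c + 4 * ((n + 1 : ℕ) : ℝ) = 2 * (c + 2 * n + 2) := by push_cast; ring
        have e4 : 2 * c + 4 * (n : ℝ) = 2 * (c + 2 * n) := by ring
        rw [e2, e3, e4]
        have h1 : c + 2 * (n : ℝ) ≠ 0 := by positivity
        have h2 : c + 2 * (n : ℝ) + 2 ≠ 0 := by positivity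
        field_simp
        ring
    simp only [e]
    have ht : Tendsto (fun n : ℕ => 1 / (2 * c + 4 * (n : ℝ))) atTop (𝓝 0) := by
      refine tendsto_const_nhds.div_atTop (tendsto_atTop_add_const_left _ _ ?_)
      exact tendsto_natCast_atTop_atTop.const_mul_atTop (by norm_num)
    simpa using tendsto_const_nhds.sub ht
  · intro n
    have hn : (0 : ℝ) ≤ n := n.cast_nonneg
    exact one_div_nonneg.2 (by nlinarith)

/-- Positive and negative `j` give telescoping series with `c = 1 + x` and `c = 1 - x`, and
`1/(2(1+x)) + 1/(2(1-x)) = 1/(1-x²)`. For `β = 1` this is the invariance of `weight`; for all `β ≤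
1` the series is the dominating one. -/
theorem hasSum_weight {x : ℝ} (hx : x ∈ Ioo (-1 : ℝ) 1) :
    HasSum (fun j : NZ => 1 / ((x + 2 * (j : ℤ)) ^ 2 - 1)) (weight x) := by
  let f : ℤ → ℝ := fun j => 1 / ((x + 2 * j) ^ 2 - 1)
  change HasSum (f ∘ ((↑) : ({j : ℤ | j ≠ 0} : Set ℤ) → ℤ)) _
  rw [hasSum_subtype_iff_indicator]
  have h1 : 0 < 1 + x := by linarith [hx.1]
  have h2 : 0 < 1 - x := by linarith [hx.2]
  have hp : HasSum (fun n : ℕ => indicator {j : ℤ | j ≠ 0} f ((n : ℤ) + 1))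
      (1 / (2 * (1 + x))) := by
    convert hasSum_telescope h1 using 2 with n
    rw [indicator_of_mem (by simp only [mem_ofPred_eq]; omega)]
    simp only [f]
    push_cast
    ring_nf
  have hn : HasSum (fun n : ℕ => indicator {j : ℤ | j ≠ 0} f (-((n : ℤ) + 1)))
      (1 / (2 * (1 - x))) := by
    convert hasSum_telescope h2 using 2 with n
    rw [indicator_of_mem (by simp only [mem_ofPred_eq]; omega)]
    simp only [f]
    push_cast
    ring_nf
  convert hp.of_add_one_of_neg_add_one hn using 1
  rw [indicator_of_notMem (by simp), weight]
  have : 1 - x ^ 2 = (1 - x) * (1 + x) := by ring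
  rw [this]
  field_simp
  ring

theorem term_weight {β : ℝ} (hβ₀ : 0 < β) (hβ₁ : β ≤ 1) {x : ℝ} (hx : x ∈ Ioo (-1 : ℝ) 1)
    (j : NZ) : term β weight x j = β / ((x + 2 * (j : ℤ)) ^ 2 - β ^ 2) := by
  have h := one_lt_sq hx j
  have h0 : (x + 2 * ((j : ℤ) : ℝ)) ≠ 0 := by
    intro h0; rw [h0] at h; norm_num at h
  have h1 : (x + 2 * ((j : ℤ) : ℝ)) ^ 2 - β ^ 2 ≠ 0 := by nlinarith
  rw [term, weight, branch, div_pow, one_sub_div (pow_ne_zero 2 h0), neg_sq, inv_div]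
  field_simp

/-- With `u = x + 2j`, cross-multiplying leaves `(u² - β²) - β(u² - 1) = (1 - β)(u² + β) ≥ 0`,
strict exactly when `β < 1`. -/
theorem term_weight_le {β : ℝ} (hβ₀ : 0 < β) (hβ₁ : β ≤ 1) {x : ℝ} (hx : x ∈ Ioo (-1 : ℝ) 1)
    (j : NZ) : term β weight x j ≤ 1 / ((x + 2 * (j : ℤ)) ^ 2 - 1) := by
  have h := one_lt_sq hx j
  rw [term_weight hβ₀ hβ₁ hx, div_le_div_iff₀ (by nlinarith) (by linarith)]
  nlinarith

theorem term_weight_lt {β : ℝ} (hβ₀ : 0 < β) (hβ₁ : β < 1) {x : ℝ} (hx : x ∈ Ioo (-1 : ℝ) 1)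
    (j : NZ) : term β weight x j < 1 / ((x + 2 * (j : ℤ)) ^ 2 - 1) := by
  have h := one_lt_sq hx j
  rw [term_weight hβ₀ hβ₁.le hx, div_lt_div_iff₀ (by nlinarith) (by linarith)]
  nlinarith

theorem coeff_pos {β : ℝ} (hβ₀ : 0 < β) {x : ℝ} (hx : x ∈ Ioo (-1 : ℝ) 1) (j : NZ) :
    0 < β / (x + 2 * (j : ℤ)) ^ 2 :=
  div_pos hβ₀ (by linarith [one_lt_sq hx j])

/-! ### The invariant cone and its Harnack inequalities. -/

/-- A cone of densities, stable under the transfer operator, whose members satisfy a Harnack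
inequality. -/
structure Good (f : ℝ → ℝ) : Prop where
  even : ∀ x ∈ Ioo (-1 : ℝ) 1, f (-x) = f x
  nonneg : ∀ x ∈ Ioo (-1 : ℝ) 1, 0 ≤ f x
  le_weight : ∀ x ∈ Ioo (-1 : ℝ) 1, f x ≤ weight x
  anti : AntitoneOn (fun x => f x * (1 - x) ^ 2) (Ioo (-1) 1)

theorem neg_mem_Ioo {x : ℝ} (hx : x ∈ Ioo (-1 : ℝ) 1) : -x ∈ Ioo (-1 : ℝ) 1 :=
  ⟨by linarith [hx.2], by linarith [hx.1]⟩

theorem good_one : Good (fun _ => 1) where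
  even _ _ := rfl
  nonneg _ _ := zero_le_one
  le_weight _ hx := one_le_weight hx
  anti := by
    intro x hx y hy hxy
    simp only [one_mul]
    exact pow_le_pow_left₀ (by linarith [hy.2]) (by linarith) 2

section

variable {β : ℝ} {f : ℝ → ℝ}

theorem Good.term_nonneg (hf : Good f) (hβ₀ : 0 < β) (hβ₁ : β ≤ 1) {x : ℝ}
    (hx : x ∈ Ioo (-1 : ℝ) 1) (j : NZ) : 0 ≤ term β f x j :=
  mul_nonneg (coeff_pos hβ₀ hx j).le (hf.nonneg _ (branch_mem hβ₀ hβ₁ hx j))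

theorem Good.term_le (hf : Good f) (hβ₀ : 0 < β) (hβ₁ : β ≤ 1) {x : ℝ}
    (hx : x ∈ Ioo (-1 : ℝ) 1) (j : NZ) :
    term β f x j ≤ 1 / ((x + 2 * (j : ℤ)) ^ 2 - 1) :=
  (mul_le_mul_of_nonneg_left (hf.le_weight _ (branch_mem hβ₀ hβ₁ hx j))
    (coeff_pos hβ₀ hx j).le).trans (term_weight_le hβ₀ hβ₁ hx j)

theorem Good.summable (hf : Good f) (hβ₀ : 0 < β) (hβ₁ : β ≤ 1) {x : ℝ}
    (hx : x ∈ Ioo (-1 : ℝ) 1) : Summable (term β f x) :=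
  Summable.of_nonneg_of_le (hf.term_nonneg hβ₀ hβ₁ hx) (hf.term_le hβ₀ hβ₁ hx)
    (hasSum_weight hx).summable

theorem term_neg (hβ₀ : 0 < β) (hβ₁ : β ≤ 1) (hf : Good f) {x : ℝ}
    (hx : x ∈ Ioo (-1 : ℝ) 1) (j : NZ) :
    term β f (-x) j = term β f x ⟨-j, neg_ne_zero.2 j.2⟩ := by
  have e : (-x + 2 * ((j : ℤ) : ℝ)) = -(x + 2 * ((-(j : ℤ) : ℤ) : ℝ)) := by push_cast; ring
  have e2 : branch β j (-x) = -branch β ⟨-j, neg_ne_zero.2 j.2⟩ x := by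
    simp only [branch]
    rw [e, div_neg]
  rw [term, term, e2, hf.even _ (branch_mem hβ₀ hβ₁ hx _), e, neg_sq]

/-- Since `1 - branch β j x = (x + 2j + β)/(x + 2j)`, the factor `(x + 2j)²` cancels. What remains
is the cone quantity at the increasing point `branch β j x`, times the square of a Möbius function
whose modulus decreases. -/
theorem Good.term_anti (hf : Good f) (hβ₀ : 0 < β) (hβ₁ : β ≤ 1) (j : NZ) :
    AntitoneOn (fun x => term β f x j * (1 - x) ^ 2) (Ioo (-1) 1) := by
  have key : ∀ x ∈ Ioo (-1 : ℝ) 1, term β f x j * (1 - x) ^ 2 =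
      β * (f (branch β j x) * (1 - branch β j x) ^ 2)
        * ((1 - x) / (x + 2 * (j : ℤ) + β)) ^ 2 := by
    intro x hx
    have h0 : x + 2 * ((j : ℤ) : ℝ) ≠ 0 := by
      rcases one_lt_or_lt_neg_one hx j with h | h <;> linarith
    have h1 : x + 2 * ((j : ℤ) : ℝ) + β ≠ 0 := by
      rcases one_lt_or_lt_neg_one hx j with h | h
      · linarith
      · exact (by linarith : x + 2 * ((j : ℤ) : ℝ) + β < 0).ne
    have e : 1 - branch β j x = (x + 2 * (j : ℤ) + β) / (x + 2 * (j : ℤ)) := by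
      rw [branch, eq_div_iff h0, sub_mul, div_mul_cancel₀ _ h0]; ring
    rw [e, term]
    field_simp
  intro x hx y hy hxy
  simp only
  rw [key x hx, key y hy]
  have hb : branch β j x ≤ branch β j y := by
    simp only [branch, neg_div, neg_le_neg_iff]
    rcases j.one_le_or with h | h
    · exact div_le_div_of_nonneg_left hβ₀.le (by linarith [hx.1]) (by linarith)
    · rw [← neg_le_neg_iff, ← div_neg, ← div_neg]
      exact div_le_div_of_nonneg_left hβ₀.le (by linarith [hy.2]) (by linarith)
  have hanti := hf.anti (branch_mem hβ₀ hβ₁ hx j) (branch_mem hβ₀ hβ₁ hy j) hb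
  simp only at hanti
  have hsq : ((1 - y) / (y + 2 * (j : ℤ) + β)) ^ 2 ≤ ((1 - x) / (x + 2 * (j : ℤ) + β)) ^ 2 := by
    have hx1 : 0 < 1 - x := by linarith [hx.2]
    have hy1 : 0 < 1 - y := by linarith [hy.2]
    have hx2 := hx.1
    have hy2 := hy.1
    rcases j.one_le_or with h | h
    · have px : 0 < x + 2 * ((j : ℤ) : ℝ) + β := by linarith
      refine pow_le_pow_left₀ (div_nonneg hy1.le (by linarith)) ?_ 2
      exact div_le_div₀ hx1.le (by linarith) px (by linarith)
    · rw [← neg_sq ((1 - y) / _), ← neg_sq ((1 - x) / _), ← div_neg, ← div_neg]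
      have px : 0 < -(x + 2 * ((j : ℤ) : ℝ) + β) := by linarith
      have py : 0 < -(y + 2 * ((j : ℤ) : ℝ) + β) := by linarith
      refine pow_le_pow_left₀ (div_nonneg hy1.le py.le) ?_ 2
      rw [div_le_div_iff₀ py px]
      -- For negative `j` the quotient is `(1 - x)/(c - x)` with `c = -2j - β`; it decreases because
      -- `c ≥ 1`, which is where `β ≤ 1` enters.
      nlinarith
  have hfy : 0 ≤ f (branch β j x) := hf.nonneg _ (branch_mem hβ₀ hβ₁ hx j)
  gcongr

theorem Good.transfer (hf : Good f) (hβ₀ : 0 < β) (hβ₁ : β ≤ 1) : Good (transfer β f) where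
  even x hx := by
    simp only [GaussType.transfer, term_neg hβ₀ hβ₁ hf hx]
    exact ((Equiv.neg ℤ).subtypeEquiv (p := (· ≠ 0)) (q := (· ≠ 0)) (by simp)).tsum_eq
      (term β f x)
  nonneg x hx := tsum_nonneg (hf.term_nonneg hβ₀ hβ₁ hx)
  le_weight x hx := by
    rw [← (hasSum_weight hx).tsum_eq]
    exact (hf.summable hβ₀ hβ₁ hx).tsum_le_tsum (hf.term_le hβ₀ hβ₁ hx)
      (hasSum_weight hx).summable
  anti := by
    intro x hx y hy hxy
    simp only [GaussType.transfer, ← tsum_mul_right]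
    exact ((hf.summable hβ₀ hβ₁ hy).mul_right _).tsum_le_tsum
      (fun j => hf.term_anti hβ₀ hβ₁ j hx hy hxy) ((hf.summable hβ₀ hβ₁ hx).mul_right _)

/-- The reflection of `Good.anti` under `x ↦ -x`; the two together control `f` from both sides. -/
theorem Good.mono (hf : Good f) {x y : ℝ} (hx : x ∈ Ioo (-1 : ℝ) 1) (hy : y ∈ Ioo (-1 : ℝ) 1)
    (hxy : x ≤ y) : f x * (1 + x) ^ 2 ≤ f y * (1 + y) ^ 2 := by
  have h := hf.anti (neg_mem_Ioo hy) (neg_mem_Ioo hx) (neg_le_neg hxy)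
  simpa only [hf.even _ hx, hf.even _ hy, sub_neg_eq_add] using h

/-- In `Good.mono`, `(1 + x)² ≥ 1` and `(1 + y)² ≤ 4`. -/
theorem Good.le_four_mul (hf : Good f) {x y : ℝ} (hx : 0 ≤ x) (hxy : x ≤ y) (hy : y < 1) :
    f x ≤ 4 * f y := by
  have hxm : x ∈ Ioo (-1 : ℝ) 1 := ⟨by linarith, by linarith⟩
  have hym : y ∈ Ioo (-1 : ℝ) 1 := ⟨by linarith, by linarith⟩
  have h := hf.mono hxm hym hxy
  have := hf.nonneg _ hxm
  have := hf.nonneg _ hym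
  nlinarith [mul_nonneg (hf.nonneg _ hxm) hx, mul_nonneg (hf.nonneg _ hxm) (sq_nonneg x),
    mul_nonneg (hf.nonneg _ hym) (sub_nonneg.2 hy.le),
    mul_nonneg (hf.nonneg _ hym) (by nlinarith : 0 ≤ 1 - y ^ 2)]

/-- The two monotonicities squeeze `f y` between `A y` and `B y`, both continuous with value `f x`
at `x`. -/
theorem Good.continuousOn (hf : Good f) : ContinuousOn f (Ioo (-1) 1) := by
  intro x hx
  refine ContinuousAt.continuousWithinAt ?_
  let A : ℝ → ℝ := fun y => f x * (1 - x) ^ 2 / (1 - y) ^ 2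
  let B : ℝ → ℝ := fun y => f x * (1 + x) ^ 2 / (1 + y) ^ 2
  have h1 : 1 - x ≠ 0 := by linarith [hx.2]
  have h2 : 1 + x ≠ 0 := by linarith [hx.1]
  have hA : Tendsto A (𝓝 x) (𝓝 (f x)) := by
    have : ContinuousAt A x := by
      refine ContinuousAt.div (by fun_prop) (by fun_prop) (pow_ne_zero 2 h1)
    have e : A x = f x := by simp only [A]; field_simp
    rw [← e]; exact this
  have hB : Tendsto B (𝓝 x) (𝓝 (f x)) := by
    have : ContinuousAt B x := by
      refine ContinuousAt.div (by fun_prop) (by fun_prop) (pow_ne_zero 2 h2)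
    have e : B x = f x := by simp only [B]; field_simp
    rw [← e]; exact this
  have hmin := hA.min hB
  have hmax := hA.max hB
  rw [min_self] at hmin
  rw [max_self] at hmax
  have key : ∀ y ∈ Ioo (-1 : ℝ) 1, min (A y) (B y) ≤ f y ∧ f y ≤ max (A y) (B y) := by
    intro y hy
    have p1 : 0 < (1 - y) ^ 2 := pow_pos (by linarith [hy.2]) 2
    have p2 : 0 < (1 + y) ^ 2 := pow_pos (by linarith [hy.1]) 2
    rcases le_total x y with h | h
    · exact ⟨min_le_of_right_le ((div_le_iff₀ p2).2 (hf.mono hx hy h)),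
        le_max_of_le_left ((le_div_iff₀ p1).2 (hf.anti hx hy h))⟩
    · exact ⟨min_le_of_left_le ((div_le_iff₀ p1).2 (hf.anti hy hx h)),
        le_max_of_le_right ((le_div_iff₀ p2).2 (hf.mono hy hx h))⟩
  have hmem : ∀ᶠ y in 𝓝 x, y ∈ Ioo (-1 : ℝ) 1 := Ioo_mem_nhds hx.1 hx.2
  exact tendsto_of_tendsto_of_tendsto_of_le_of_le' hmin hmax
    (hmem.mono fun y hy => (key y hy).1) (hmem.mono fun y hy => (key y hy).2)

/-! ### Endpoint decay and the maximum principle. -/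

/-- Decay at the endpoints of a density whose dyadic lower sums are bounded. -/
theorem Good.exists_decay (hf : Good f) {B : ℝ}
    (hB : ∀ m, ∑ k ∈ Finset.range m, f (1 - (1 / 2) ^ k) * (1 / 2) ^ k ≤ B)
    {c : ℝ} (hc : 0 < c) :
    ∃ a, 0 ≤ a ∧ a < 1 ∧ ∀ x ∈ Ioo (-1 : ℝ) 1, a < |x| → f x * (1 - x ^ 2) < c := by
  have hmem : ∀ k : ℕ, (1 : ℝ) - (1 / 2) ^ k ∈ Ioo (-1 : ℝ) 1 := fun k => by
    have h1 : (0 : ℝ) < (1 / 2) ^ k := by positivity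
    have h2 : ((1 : ℝ) / 2) ^ k ≤ 1 := pow_le_one₀ (by norm_num) (by norm_num)
    exact ⟨by linarith, by linarith⟩
  have hs := summable_of_sum_range_le
    (fun k => mul_nonneg (hf.nonneg _ (hmem k)) (by positivity : (0 : ℝ) ≤ (1 / 2) ^ k)) hB
  obtain ⟨n, hn⟩ := eventually_atTop.1
    -- The 16 absorbs two factors 4: the Harnack constant, and `1 - x² ≤ 2(1 - x) ≤ 4 (1/2)^(k+1)`.
    (hs.tendsto_atTop_zero.eventually_lt_const (by positivity : 0 < c / 16))
  have hpos : ∀ x ∈ Ioo (-1 : ℝ) 1, 0 ≤ x → 1 - (1 / 2 : ℝ) ^ n < x → f x * (1 - x ^ 2) < c := by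
    intro x hx hx0 hax
    obtain ⟨k, hk1, hk2⟩ := exists_nat_pow_near_of_lt_one (x := 1 - x) (y := (1 / 2 : ℝ))
      (by linarith [hx.2]) (by linarith) (by norm_num) (by norm_num)
    have hnk : n ≤ k + 1 := by
      by_contra hlt
      have : (1 / 2 : ℝ) ^ n ≤ (1 / 2) ^ (k + 1) :=
        pow_le_pow_of_le_one (by norm_num) (by norm_num) (by omega)
      linarith
    have h1 := hn _ hnk
    have h2 : f x ≤ 4 * f (1 - (1 / 2) ^ (k + 1)) :=
      hf.le_four_mul hx0 (by linarith) (hmem _).2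
    have h3 := hf.nonneg _ hx
    have h5 : 1 - x ^ 2 ≤ 4 * (1 / 2 : ℝ) ^ (k + 1) := by
      have : (1 / 2 : ℝ) ^ k = 2 * (1 / 2) ^ (k + 1) := by rw [pow_succ]; ring
      nlinarith
    calc f x * (1 - x ^ 2)
        ≤ (4 * f (1 - (1 / 2) ^ (k + 1))) * (4 * (1 / 2 : ℝ) ^ (k + 1)) :=
          mul_le_mul h2 h5 (one_sub_sq_pos hx).le (by linarith)
      _ < c := by linarith
  refine ⟨1 - (1 / 2) ^ n, ?_, ?_, fun x hx hax => ?_⟩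
  · linarith [pow_le_one₀ (n := n) (by norm_num : (0 : ℝ) ≤ 1 / 2) (by norm_num)]
  · exact (hmem n).2
  rcases le_total 0 x with h | h
  · exact hpos x hx h (by rwa [abs_of_nonneg h] at hax)
  · have := hpos (-x) (neg_mem_Ioo hx) (by linarith) (by rwa [abs_of_nonpos h] at hax)
    rwa [hf.even x hx, neg_sq] at this

/-- The maximum principle: a density fixed by the transfer operator which is small compared with
the weight at the endpoints vanishes. -/
theorem Good.eq_zero_of_transfer_eq (hβ₀ : 0 < β) (hβ₁ : β ≤ 1) (hf : Good f)
    (hfix : ∀ x ∈ Ioo (-1 : ℝ) 1, GaussType.transfer β f x = f x)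
    (hdec : ∀ c : ℝ, 0 < c →
      ∃ a, 0 ≤ a ∧ a < 1 ∧ ∀ x ∈ Ioo (-1 : ℝ) 1, a < |x| → f x * (1 - x ^ 2) < c)
    {x₀ : ℝ} (hx₀ : x₀ ∈ Ioo (-1 : ℝ) 1) : f x₀ = 0 := by
  by_contra hne
  have hpos : 0 < f x₀ * (1 - x₀ ^ 2) :=
    mul_pos (lt_of_le_of_ne (hf.nonneg _ hx₀) (Ne.symm hne)) (one_sub_sq_pos hx₀)
  -- With the threshold `f x₀ (1 - x₀²)`, points outside `[-a, a]` cannot compete with `x₀`, so the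
  -- supremum of `q` is attained.
  obtain ⟨a, ha0, ha1, ha⟩ := hdec _ hpos
  let q : ℝ → ℝ := fun x => f x * (1 - x ^ 2)
  have hsub : Icc (-a) a ⊆ Ioo (-1 : ℝ) 1 := fun x hx =>
    ⟨by linarith [hx.1], by linarith [hx.2]⟩
  have hqc : ContinuousOn q (Icc (-a) a) :=
    (hf.continuousOn.mono hsub).mul (by fun_prop)
  have hx₀a : x₀ ∈ Icc (-a) a := by
    by_contra h
    exact lt_irrefl _ (ha x₀ hx₀ (not_le.1 fun h' => h (abs_le.1 h')))
  obtain ⟨m, hm, hmax⟩ := isCompact_Icc.exists_isMaxOn ⟨x₀, hx₀a⟩ hqc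
  set M := q m with hM
  have hMpos : q x₀ ≤ M := hmax hx₀a
  have hM0 : 0 < M := hpos.trans_le hMpos
  have hin : ∀ x ∈ Ioo (-1 : ℝ) 1, M ≤ q x → x ∈ Icc (-a) a := by
    intro x hx hq
    by_contra h
    exact lt_irrefl _ ((ha x hx (not_le.1 fun h' => h (abs_le.1 h'))).trans_le
      (hMpos.trans hq))
  have hqM : ∀ x ∈ Ioo (-1 : ℝ) 1, q x ≤ M := by
    intro x hx
    by_contra h
    exact h (hmax (hin x hx (not_le.1 h).le))
  have hfM : ∀ x ∈ Ioo (-1 : ℝ) 1, f x ≤ M * weight x := by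
    intro x hx
    rw [weight, ← div_eq_mul_inv, le_div_iff₀ (one_sub_sq_pos hx)]
    exact hqM x hx
  have hcomp : IsCompact (Icc (-a) a ∩ q ⁻¹' Ici M) :=
    isCompact_Icc.of_isClosed_subset (hqc.preimage_isClosed_of_isClosed isClosed_Icc isClosed_Ici)
      inter_subset_left
  -- The greatest maximiser is chosen because, for `β = 1`, the branch `j = -1` produces a maximiser
  -- further right.
  obtain ⟨x, ⟨hxa, hxM⟩, hgr⟩ := hcomp.exists_isGreatest ⟨m, hm, le_refl M⟩
  have hx : x ∈ Ioo (-1 : ℝ) 1 := hsub hxa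
  have hx0 : 0 ≤ x := by
    have : -x ≤ x := hgr ⟨⟨by linarith [hxa.2], by linarith [hxa.1]⟩, by
      change M ≤ f (-x) * (1 - (-x) ^ 2)
      rw [hf.even x hx, neg_sq]; exact hxM⟩
    linarith
  have hfx : f x = M * weight x := by
    refine le_antisymm (hfM x hx) ?_
    rw [weight, ← div_eq_mul_inv, div_le_iff₀ (one_sub_sq_pos hx)]
    exact hxM
  have hterm : ∀ j, term β f x j ≤ M * term β weight x j := by
    intro j
    have := mul_le_mul_of_nonneg_left (hfM _ (branch_mem hβ₀ hβ₁ hx j)) (coeff_pos hβ₀ hx j).le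
    rw [term, term]
    linarith
  have hterm' : ∀ j, M * term β weight x j ≤ M * (1 / ((x + 2 * ((j : ℤ) : ℝ)) ^ 2 - 1)) :=
    fun j => mul_le_mul_of_nonneg_left (term_weight_le hβ₀ hβ₁ hx j) hM0.le
  -- Both series sum to `f x = M * weight x`, so a termwise inequality can be strict nowhere.
  have heq : ∀ j, ¬ term β f x j < M * (1 / ((x + 2 * ((j : ℤ) : ℝ)) ^ 2 - 1)) := by
    intro j hj
    have h1 : HasSum (term β f x) (f x) := by
      rw [← hfix x hx]; exact (hf.summable hβ₀ hβ₁ hx).hasSum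
    have := hasSum_lt (fun j => (hterm j).trans (hterm' j)) hj h1 ((hasSum_weight hx).mul_left M)
    exact this.ne hfx
  let j : NZ := ⟨-1, by norm_num⟩
  rcases hβ₁.lt_or_eq with hlt | rfl
  · exact heq j ((hterm j).trans_lt
      (mul_lt_mul_of_pos_left (term_weight_lt hβ₀ hlt hx j) hM0))
  · have hb := branch_mem hβ₀ hβ₁ hx j
    have hbx : x < branch 1 j x := by
      have h2 : 0 < 2 - x := by linarith [hx.2]
      have : branch 1 j x = 1 / (2 - x) := by
        simp only [branch, j]
        rw [← neg_div_neg_eq]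
        push_cast
        ring_nf
      rw [this, lt_div_iff₀ h2]
      -- The claim `x (2 - x) < 1` is `(1 - x)² > 0`.
      nlinarith [hx.2]
    have hqb : M ≤ q (branch 1 j x) := by
      by_contra h
      have hlt : f (branch 1 j x) < M * weight (branch 1 j x) := by
        rw [weight, ← div_eq_mul_inv, lt_div_iff₀ (one_sub_sq_pos hb)]
        exact not_le.1 h
      have := mul_lt_mul_of_pos_left hlt (coeff_pos hβ₀ hx j)
      refine heq j (lt_of_lt_of_le ?_ (hterm' j))
      rw [term, term]
      linarith
    exact absurd (hgr ⟨hin _ hb hqb, hqb⟩) (not_le.2 hbx)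

end

/-! ### Preimages under the map and duality with the transfer operator. -/

/-- The points of `]-β,β]` which `U β` sends into `S`. -/
def survivors (β : ℝ) (S : Set ℝ) : Set ℝ := Ioc (-β) β ∩ U β ⁻¹' S

theorem measurableSet_survivors (β : ℝ) {S : Set ℝ} (hS : MeasurableSet S) :
    MeasurableSet (survivors β S) :=
  measurableSet_Ioc.inter (measurable_U β hS)

theorem survivors_subset {β : ℝ} (hβ₁ : β ≤ 1) (S : Set ℝ) :
    survivors β S ⊆ Ioc (-1) 1 :=
  inter_subset_left.trans (Ioc_subset_Ioc (by linarith) hβ₁)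

theorem mod2_add_two_mul {x : ℝ} (hx : x ∈ Ioc (-1 : ℝ) 1) (j : ℤ) : mod2 (x + 2 * j) = x := by
  have e : x + 2 * (j : ℝ) = x + j • (2 : ℝ) := by rw [zsmul_eq_mul]; ring
  rw [mod2, e, toIocMod_add_zsmul, toIocMod_eq_self, show (-1 : ℝ) + 2 = 1 by norm_num]
  exact hx

theorem exists_eq_mod2_add (t : ℝ) : ∃ j : ℤ, t = mod2 t + 2 * j := by
  refine ⟨toIocDiv (two_pos : (0 : ℝ) < 2) (-1) t, ?_⟩
  have := toIocMod_add_toIocDiv_zsmul (two_pos : (0 : ℝ) < 2) (-1) t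
  rw [zsmul_eq_mul] at this
  rw [mod2]
  linarith

theorem denom_ne_zero {x : ℝ} (hx : x ∈ Ioc (-1 : ℝ) 1) (j : NZ) : x + 2 * (j : ℤ) ≠ 0 := by
  rcases j.one_le_or with h | h
  · linarith [hx.1]
  · exact (by linarith [hx.2] : x + 2 * ((j : ℤ) : ℝ) < 0).ne

theorem neg_div_branch {β : ℝ} (hβ₀ : 0 < β) {x : ℝ} (hx : x ∈ Ioc (-1 : ℝ) 1) (j : NZ) :
    -β / branch β j x = x + 2 * (j : ℤ) := by
  have := denom_ne_zero hx j
  have := hβ₀.ne'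
  rw [branch]
  field_simp

theorem branch_ne_zero {β : ℝ} (hβ₀ : 0 < β) {x : ℝ} (hx : x ∈ Ioc (-1 : ℝ) 1) (j : NZ) :
    branch β j x ≠ 0 :=
  div_ne_zero (by linarith) (denom_ne_zero hx j)

theorem U_branch {β : ℝ} (hβ₀ : 0 < β) {x : ℝ} (hx : x ∈ Ioc (-1 : ℝ) 1) (j : NZ) :
    U β (branch β j x) = x := by
  rw [U, if_neg (branch_ne_zero hβ₀ hx j), neg_div_branch hβ₀ hx, mod2_add_two_mul hx]

theorem branch_mem_Ioc {β : ℝ} (hβ₀ : 0 < β) {x : ℝ} (hx : x ∈ Ioc (-1 : ℝ) 1) (j : NZ) :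
    branch β j x ∈ Ioc (-β) β := by
  rw [branch]
  rcases j.one_le_or with h | h
  · have hp : 1 < x + 2 * ((j : ℤ) : ℝ) := by linarith [hx.1]
    have h1 : β / (x + 2 * ((j : ℤ) : ℝ)) < β := div_lt_self hβ₀ hp
    have h2 : 0 < β / (x + 2 * ((j : ℤ) : ℝ)) := div_pos hβ₀ (by linarith)
    rw [neg_div]
    exact ⟨by linarith, by linarith⟩
  · have hp : 1 ≤ -(x + 2 * ((j : ℤ) : ℝ)) := by linarith [hx.2]
    have h1 : β / -(x + 2 * ((j : ℤ) : ℝ)) ≤ β := div_le_self hβ₀.le hp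
    have h2 : 0 < β / -(x + 2 * ((j : ℤ) : ℝ)) := div_pos hβ₀ (by linarith)
    rw [neg_div, ← div_neg]
    exact ⟨by linarith, h1⟩

/-- The point 0 is removed because no branch reaches it; its value under `U β` is a convention. -/
theorem iUnion_branch_image {β : ℝ} (hβ₀ : 0 < β) {S : Set ℝ} (hS : S ⊆ Ioc (-1) 1) :
    ⋃ j : NZ, branch β j '' S = survivors β S \ {0} := by
  ext y
  simp only [mem_iUnion, mem_image, Set.mem_sdiff, mem_singleton_iff]
  constructor
  · rintro ⟨j, x, hx, rfl⟩
    refine ⟨⟨branch_mem_Ioc hβ₀ (hS hx) j, ?_⟩, branch_ne_zero hβ₀ (hS hx) j⟩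
    rw [mem_preimage, U_branch hβ₀ (hS hx)]
    exact hx
  · rintro ⟨⟨hy, hyS⟩, hy0⟩
    rw [mem_preimage, U, if_neg hy0] at hyS
    obtain ⟨j, hj⟩ := exists_eq_mod2_add (-β / y)
    have hj0 : j ≠ 0 := by
      -- Index 0 would put `-β / y` in `]-1,1]`, forcing `y ≤ -β` or `y > β`.
      rintro rfl
      rw [Int.cast_zero, mul_zero, add_zero] at hj
      have hm := hS hyS
      rw [← hj] at hm
      rcases lt_or_gt_of_ne hy0 with h | h
      · have := hm.2
        rw [div_le_iff_of_neg h] at this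
        linarith [hy.1]
      · have := hm.1
        rw [lt_div_iff₀ h] at this
        linarith [hy.2]
    refine ⟨⟨j, hj0⟩, _, hyS, ?_⟩
    rw [branch]
    simp only
    rw [← hj]
    have := hβ₀.ne'
    field_simp

theorem branch_injOn {β : ℝ} (hβ₀ : 0 < β) {S : Set ℝ} (hS : S ⊆ Ioc (-1) 1) (j : NZ) :
    InjOn (branch β j) S := by
  intro x hx y hy h
  rw [← U_branch hβ₀ (hS hx) j, h, U_branch hβ₀ (hS hy) j]

theorem branch_hasDerivAt (β : ℝ) {x : ℝ} (hx : x ∈ Ioc (-1 : ℝ) 1) (j : NZ) :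
    HasDerivAt (branch β j) (β / (x + 2 * (j : ℤ)) ^ 2) x := by
  have h := ((hasDerivAt_id x).add_const (2 * ((j : ℤ) : ℝ))).fun_inv (denom_ne_zero hx j)
  have h' := h.const_mul (-β)
  have e : β / (x + 2 * ((j : ℤ) : ℝ)) ^ 2 = -β * (-1 / (id x + 2 * ((j : ℤ) : ℝ)) ^ 2) := by
    rw [id_eq]; ring
  rw [e]
  exact h'

theorem pairwise_disjoint_branch_image {β : ℝ} (hβ₀ : 0 < β) {S : Set ℝ}
    (hS : S ⊆ Ioc (-1) 1) : Pairwise (Function.onFun Disjoint fun j : NZ => branch β j '' S) := by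
  intro i j hij
  rw [Function.onFun, Set.disjoint_left]
  rintro _ ⟨x, hx, rfl⟩ ⟨y, hy, hxy⟩
  have e : y = x := by rw [← U_branch hβ₀ (hS hx) i, ← hxy, U_branch hβ₀ (hS hy) j]
  have h1 := neg_div_branch hβ₀ (hS hx) i
  rw [← hxy, neg_div_branch hβ₀ (hS hy) j, e] at h1
  exact hij (Subtype.ext (by exact_mod_cast (by linarith : ((i : ℤ) : ℝ) = (j : ℤ))))

/-- `Good` says nothing at the endpoint 1, where the transfer series need not be controlled; the
endpoint is discarded as a null set. -/
theorem restrict_inter_Ioo {S : Set ℝ} (hS : S ⊆ Ioc (-1) 1) :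
    volume.restrict (S ∩ Ioo (-1) 1) = volume.restrict S := by
  refine Measure.restrict_congr_set ?_
  have h : (Ioo (-1 : ℝ) 1 : Set ℝ) =ᵐ[volume] Ioc (-1) 1 := Ioo_ae_eq_Ioc
  have h2 := (ae_eq_refl S).inter h
  rwa [inter_eq_left.2 hS] at h2

/-- The transfer operator is dual to the composition with `U β`. -/
theorem setLIntegral_survivors {β : ℝ} (hβ₀ : 0 < β) (hβ₁ : β ≤ 1) {f : ℝ → ℝ} (hf : Good f)
    {S : Set ℝ} (hSm : MeasurableSet S) (hS : S ⊆ Ioc (-1) 1) :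
    ∫⁻ x in survivors β S, ENNReal.ofReal (f x) = ∫⁻ x in S, ENNReal.ofReal (transfer β f x) := by
  have hcont : ∀ j, ContinuousOn (branch β j) S := fun j x hx =>
    (branch_hasDerivAt β (hS hx) j).continuousAt.continuousWithinAt
  have h0 : volume.restrict (survivors β S) = volume.restrict (⋃ j : NZ, branch β j '' S) := by
    rw [iUnion_branch_image hβ₀ hS]
    exact Measure.restrict_congr_set (sdiff_null_ae_eq_self (by simp)).symm
  rw [h0, lintegral_iUnion
    (fun j => hSm.image_of_continuousOn_injOn (hcont j) (branch_injOn hβ₀ hS j))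
    (pairwise_disjoint_branch_image hβ₀ hS)]
  have h1 : ∀ j : NZ, ∫⁻ x in branch β j '' S, ENNReal.ofReal (f x)
      = ∫⁻ x in S ∩ Ioo (-1) 1, ENNReal.ofReal (term β f x j) := by
    intro j
    -- Change of variables along each branch: its derivative is the coefficient in `term`.
    rw [lintegral_image_eq_lintegral_abs_deriv_mul hSm
      (fun x hx => (branch_hasDerivAt β (hS hx) j).hasDerivWithinAt) (branch_injOn hβ₀ hS j),
      restrict_inter_Ioo hS]
    refine lintegral_congr fun x => ?_
    have : 0 ≤ β / (x + 2 * ((j : ℤ) : ℝ)) ^ 2 := by positivity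
    rw [abs_of_nonneg this, term, ENNReal.ofReal_mul this]
  simp only [h1]
  rw [← lintegral_tsum, ← restrict_inter_Ioo hS]
  · refine setLIntegral_congr_fun (hSm.inter measurableSet_Ioo) fun x hx => ?_
    rw [transfer, ENNReal.ofReal_tsum_of_nonneg (hf.term_nonneg hβ₀ hβ₁ hx.2)
      (hf.summable hβ₀ hβ₁ hx.2)]
  · intro j
    refine (ContinuousOn.aemeasurable ?_ (hSm.inter measurableSet_Ioo)).ennreal_ofReal
    refine ContinuousOn.mul ?_ (hf.continuousOn.comp ((hcont j).mono inter_subset_left)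
      fun x hx => branch_mem hβ₀ hβ₁ hx.2 j)
    refine continuousOn_const.div (by fun_prop) fun x hx => ?_
    exact pow_ne_zero 2 (denom_ne_zero (hS hx.1) j)

/-! ### Iterated densities and their Cesàro means. -/

/-- The image of Lebesgue measure under `n` steps of `U β` has density `dens β n`. -/
def dens (β : ℝ) (n : ℕ) : ℝ → ℝ := (transfer β)^[n] fun _ => 1

theorem dens_succ (β : ℝ) (n : ℕ) : dens β (n + 1) = transfer β (dens β n) :=
  Function.iterate_succ_apply' _ _ _

section

variable {β : ℝ}

theorem good_dens (hβ₀ : 0 < β) (hβ₁ : β ≤ 1) (n : ℕ) : Good (dens β n) := by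
  induction n with
  | zero => exact good_one
  | succ n ih => rw [dens_succ]; exact ih.transfer hβ₀ hβ₁

theorem iterate_survivors (hβ₁ : β ≤ 1) {K : Set ℝ} (hKm : MeasurableSet K)
    (hK : K ⊆ Ioc (-1) 1) (n : ℕ) :
    MeasurableSet ((survivors β)^[n] K) ∧ (survivors β)^[n] K ⊆ Ioc (-1) 1 := by
  induction n with
  | zero => exact ⟨hKm, hK⟩
  | succ n ih =>
    rw [Function.iterate_succ_apply']
    exact ⟨measurableSet_survivors β ih.1, survivors_subset hβ₁ _⟩

theorem setLIntegral_dens (hβ₀ : 0 < β) (hβ₁ : β ≤ 1) {K : Set ℝ} (hKm : MeasurableSet K)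
    (hK : K ⊆ Ioc (-1) 1) (n : ℕ) :
    ∫⁻ x in K, ENNReal.ofReal (dens β n x) = volume ((survivors β)^[n] K) := by
  -- The index `m` stays free in the induction: each step trades one preimage for one application of
  -- `transfer β`.
  have key : ∀ n m, ∫⁻ x in (survivors β)^[n] K, ENNReal.ofReal (dens β m x)
      = ∫⁻ x in K, ENNReal.ofReal (dens β (m + n) x) := by
    intro n
    induction n with
    | zero => intro m; rfl
    | succ n ih =>
      intro m
      have hm := iterate_survivors hβ₁ hKm hK n
      rw [Function.iterate_succ_apply', setLIntegral_survivors hβ₀ hβ₁ (good_dens hβ₀ hβ₁ m)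
        hm.1 hm.2, ← dens_succ, ih (m + 1)]
      congr! 4
      omega
  have h := key n 0
  rw [zero_add] at h
  rw [← h]
  simp [dens]

/-- Cesàro means of the densities `dens β n`. -/
def mean (β : ℝ) (N : ℕ) (x : ℝ) : ℝ :=
  ((N : ℝ) + 1)⁻¹ * ∑ n ∈ Finset.range (N + 1), dens β n x

theorem good_mean (hβ₀ : 0 < β) (hβ₁ : β ≤ 1) (N : ℕ) : Good (mean β N) where
  even x hx := by
    simp only [mean, fun n => (good_dens hβ₀ hβ₁ n).even x hx]
  nonneg x hx := mul_nonneg (by positivity)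
    (Finset.sum_nonneg fun n _ => (good_dens hβ₀ hβ₁ n).nonneg x hx)
  le_weight x hx := by
    have h := Finset.sum_le_card_nsmul (Finset.range (N + 1)) (fun n => dens β n x) (weight x)
      fun n _ => (good_dens hβ₀ hβ₁ n).le_weight x hx
    rw [Finset.card_range, nsmul_eq_mul] at h
    push_cast at h
    rwa [mean, inv_mul_le_iff₀ (by positivity)]
  anti := by
    intro x hx y hy hxy
    simp only [mean, mul_assoc, Finset.sum_mul]
    refine mul_le_mul_of_nonneg_left (Finset.sum_le_sum fun n _ => ?_) (by positivity)
    exact (good_dens hβ₀ hβ₁ n).anti hx hy hxy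

/-- The operator shifts the index, so only the two end terms of the sum fail to cancel. The defect
is `O(1/N)` at each point, which makes limits of the means fixed. -/
theorem transfer_mean (hβ₀ : 0 < β) (hβ₁ : β ≤ 1) (N : ℕ) {x : ℝ} (hx : x ∈ Ioo (-1 : ℝ) 1) :
    transfer β (mean β N) x = mean β N x + ((N : ℝ) + 1)⁻¹ * (dens β (N + 1) x - 1) := by
  have e : ∀ j, term β (mean β N) x j
      = ((N : ℝ) + 1)⁻¹ * ∑ n ∈ Finset.range (N + 1), term β (dens β n) x j := by
    intro j
    simp only [term, mean, ← Finset.mul_sum]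
    ring
  rw [transfer]
  simp only [e]
  rw [tsum_mul_left, Summable.tsum_finsetSum fun n _ => (good_dens hβ₀ hβ₁ n).summable hβ₀ hβ₁ hx,
    mean, ← mul_add]
  congr 1
  have h1 : ∀ n, ∑' j, term β (dens β n) x j = dens β (n + 1) x := fun n => by
    rw [dens_succ]; rfl
  simp only [h1]
  have h2 := Finset.sum_range_succ (fun n => dens β n x) (N + 1)
  rw [Finset.sum_range_succ'] at h2
  have h3 : dens β 0 x = 1 := rfl
  linarith

theorem setLIntegral_mean (hβ₀ : 0 < β) (hβ₁ : β ≤ 1) (N : ℕ) {K : Set ℝ}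
    (hKm : MeasurableSet K) (hK : K ⊆ Ioo (-1) 1) :
    ∫⁻ x in K, ENNReal.ofReal (mean β N x) = ENNReal.ofReal (((N : ℝ) + 1)⁻¹)
      * ∑ n ∈ Finset.range (N + 1), volume ((survivors β)^[n] K) := by
  have hm : ∀ n, AEMeasurable (fun x => ENNReal.ofReal (dens β n x)) (volume.restrict K) :=
    fun n => (((good_dens hβ₀ hβ₁ n).continuousOn.mono hK).aemeasurable hKm).ennreal_ofReal
  simp only [← setLIntegral_dens hβ₀ hβ₁ hKm (hK.trans Ioo_subset_Ioc_self)]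
  rw [← lintegral_finsetSum' _ fun n _ => hm n, ← lintegral_const_mul' _ _ ENNReal.ofReal_ne_top]
  refine setLIntegral_congr_fun hKm fun x hx => ?_
  rw [mean, ENNReal.ofReal_mul (by positivity),
    ENNReal.ofReal_sum_of_nonneg fun n _ => (good_dens hβ₀ hβ₁ n).nonneg x (hK hx)]

theorem ofReal_inv_mul_cast (N : ℕ) :
    ENNReal.ofReal (((N : ℝ) + 1)⁻¹) * ((N + 1 : ℕ) : ℝ≥0∞) = 1 := by
  rw [← ENNReal.ofReal_natCast, ← ENNReal.ofReal_mul (by positivity)]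
  push_cast
  rw [inv_mul_cancel₀ (by positivity), ENNReal.ofReal_one]

theorem lintegral_mean_le (hβ₀ : 0 < β) (hβ₁ : β ≤ 1) (N : ℕ) :
    ∫⁻ x in Ioo (-1) 1, ENNReal.ofReal (mean β N x) ≤ 2 := by
  rw [setLIntegral_mean hβ₀ hβ₁ N measurableSet_Ioo subset_rfl]
  have h : ∀ n ∈ Finset.range (N + 1),
      volume ((survivors β)^[n] (Ioo (-1) 1)) ≤ (2 : ℝ≥0∞) := fun n _ => by
    refine (measure_mono (iterate_survivors hβ₁ measurableSet_Ioo Ioo_subset_Ioc_self n).2).trans ?_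
    rw [Real.volume_Ioc]
    norm_num
  refine (mul_le_mul_right (Finset.sum_le_card_nsmul _ _ _ h) _).trans ?_
  rw [Finset.card_range, nsmul_eq_mul, ← mul_assoc, ofReal_inv_mul_cast, one_mul]

/-- Dyadic lower sums of a density are controlled by its mass. -/
theorem Good.sum_dyadic_le {f : ℝ → ℝ} (hf : Good f)
    (hmass : ∫⁻ x in Ioo (-1) 1, ENNReal.ofReal (f x) ≤ 2) (m : ℕ) :
    ∑ k ∈ Finset.range m, f (1 - (1 / 2) ^ k) * (1 / 2) ^ k ≤ 16 := by
  let a : ℕ → ℝ := fun k => 1 - (1 / 2) ^ k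
  have hpow : ∀ k : ℕ, (0 : ℝ) < (1 / 2) ^ k := fun k => by positivity
  have ha0 : ∀ k, 0 ≤ a k := fun k =>
    sub_nonneg.2 (pow_le_one₀ (by norm_num) (by norm_num))
  have ha1 : ∀ k, a k < 1 := fun k => by simp only [a]; linarith [hpow k]
  have hmono : Monotone a := fun i j hij =>
    sub_le_sub_left (pow_le_pow_of_le_one (by norm_num) (by norm_num) hij) 1
  have hnn : ∀ k, 0 ≤ f (a k) := fun k => hf.nonneg _ ⟨by linarith [ha0 k], ha1 k⟩
  have hpiece : ∀ k, ENNReal.ofReal (f (a k) * (1 / 2) ^ k / 8)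
      ≤ ∫⁻ x in Ico (a k) (a (k + 1)), ENNReal.ofReal (f x) := by
    intro k
    -- The 8 is the Harnack factor 4 times 2, as the interval has length `(1/2)^(k+1)`. With total
    -- mass at most 2 this gives the bound 16.
    have e : ENNReal.ofReal (f (a k) * (1 / 2) ^ k / 8)
        = ∫⁻ _ in Ico (a k) (a (k + 1)), ENNReal.ofReal (f (a k) / 4) := by
      rw [setLIntegral_const, Real.volume_Ico, ← ENNReal.ofReal_mul (by linarith [hnn k])]
      congr 1
      simp only [a]
      rw [pow_succ]
      ring
    rw [e]
    refine setLIntegral_mono' measurableSet_Ico fun x hx => ENNReal.ofReal_le_ofReal ?_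
    have := hf.le_four_mul (ha0 k) hx.1 (hx.2.trans (ha1 _))
    linarith
  have hsum : ∑ k ∈ Finset.range m, ENNReal.ofReal (f (a k) * (1 / 2) ^ k / 8) ≤ 2 := by
    refine (Finset.sum_le_sum fun k _ => hpiece k).trans ((ENNReal.sum_le_tsum _).trans ?_)
    have hdisj : Pairwise (Function.onFun Disjoint fun k => Ico (a k) (a (k + 1))) :=
      hmono.pairwise_disjoint_on_Ico_succ
    rw [← lintegral_iUnion (fun k => measurableSet_Ico) hdisj]
    refine (lintegral_mono_set ?_).trans hmass
    refine iUnion_subset fun k x hx => ⟨?_, hx.2.trans (ha1 _)⟩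
    linarith [ha0 k, hx.1]
  rw [← ENNReal.ofReal_sum_of_nonneg
    (fun k _ => div_nonneg (mul_nonneg (hnn k) (hpow k).le) (by norm_num)),
    ← Finset.sum_div] at hsum
  have h2 : (2 : ℝ≥0∞) = ENNReal.ofReal 2 := by norm_num
  rw [h2, ENNReal.ofReal_le_ofReal_iff (by norm_num)] at hsum
  have e : ∑ k ∈ Finset.range m, f (1 - (1 / 2) ^ k) * (1 / 2) ^ k
      = ∑ k ∈ Finset.range m, f (a k) * (1 / 2) ^ k := rfl
  rw [e]
  linarith

/-- Since `0 ≤ mean β N ≤ weight`, every ultrafilter finer than `atTop` yields a limit `G` at all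
points simultaneously. This `G` lies in the cone, is fixed and decays at the endpoints, hence
vanishes by the maximum principle. -/
theorem tendsto_mean (hβ₀ : 0 < β) (hβ₁ : β ≤ 1) {x : ℝ} (hx : x ∈ Ioo (-1 : ℝ) 1) :
    Tendsto (fun N => mean β N x) atTop (𝓝 0) := by
  rw [tendsto_iff_ultrafilter]
  intro 𝓤 h𝓤
  have hlim : ∀ y : Ioo (-1 : ℝ) 1, ∃ l, Tendsto (fun N => mean β N y) 𝓤 (𝓝 l) := by
    intro y
    obtain ⟨l, -, hl⟩ := (isCompact_Icc (a := (0 : ℝ)) (b := weight y)).ultrafilter_le_nhds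
      (𝓤.map fun N => mean β N y) (by
        rw [Ultrafilter.coe_map, le_principal_iff, mem_map]
        exact Eventually.of_forall fun N =>
          ⟨(good_mean hβ₀ hβ₁ N).nonneg y y.2, (good_mean hβ₀ hβ₁ N).le_weight y y.2⟩)
    exact ⟨l, hl⟩
  choose G' hG' using hlim
  let G : ℝ → ℝ := fun y => if hy : y ∈ Ioo (-1 : ℝ) 1 then G' ⟨y, hy⟩ else 0
  have hG : ∀ y ∈ Ioo (-1 : ℝ) 1, Tendsto (fun N => mean β N y) 𝓤 (𝓝 (G y)) := by
    intro y hy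
    simp only [G, dif_pos hy]
    exact hG' ⟨y, hy⟩
  have hGood : Good G := by
    refine ⟨fun y hy => ?_, fun y hy => ?_, fun y hy => ?_, fun y hy z hz hyz => ?_⟩
    · refine tendsto_nhds_unique (hG _ (neg_mem_Ioo hy)) ?_
      simpa only [fun N => (good_mean hβ₀ hβ₁ N).even y hy] using hG y hy
    · exact ge_of_tendsto' (hG y hy) fun N => (good_mean hβ₀ hβ₁ N).nonneg y hy
    · exact le_of_tendsto' (hG y hy) fun N => (good_mean hβ₀ hβ₁ N).le_weight y hy
    · exact le_of_tendsto_of_tendsto' ((hG z hz).mul_const _) ((hG y hy).mul_const _)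
        fun N => (good_mean hβ₀ hβ₁ N).anti hy hz hyz
  have hfix : ∀ y ∈ Ioo (-1 : ℝ) 1, transfer β G y = G y := by
    intro y hy
    -- The termwise bound `Good.term_le` is independent of `N` and summable over `j`.
    have h1 : Tendsto (fun N => transfer β (mean β N) y) 𝓤 (𝓝 (transfer β G y)) := by
      refine tendsto_tsum_of_dominated_convergence (hasSum_weight hy).summable (fun j => ?_)
        (Eventually.of_forall fun N j => ?_)
      · exact (hG _ (branch_mem hβ₀ hβ₁ hy j)).const_mul _
      · rw [Real.norm_of_nonneg ((good_mean hβ₀ hβ₁ N).term_nonneg hβ₀ hβ₁ hy j)]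
        exact (good_mean hβ₀ hβ₁ N).term_le hβ₀ hβ₁ hy j
    have h2 : Tendsto (fun N : ℕ => ((N : ℝ) + 1)⁻¹ * (dens β (N + 1) y - 1)) atTop (𝓝 0) := by
      have h3 : Tendsto (fun N : ℕ => ((N : ℝ) + 1)⁻¹) atTop (𝓝 0) :=
        tendsto_inv_atTop_zero.comp
          (tendsto_atTop_add_const_right _ _ tendsto_natCast_atTop_atTop)
      refine h3.zero_mul_isBoundedUnder_le ?_
      refine isBoundedUnder_of ⟨weight y + 1, fun N => ?_⟩
      have g := good_dens hβ₀ hβ₁ (N + 1)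
      have := g.nonneg y hy
      have := g.le_weight y hy
      simp only [Function.comp_apply, Real.norm_eq_abs, abs_le]
      constructor <;> linarith
    have h4 := (hG y hy).add (h2.mono_left h𝓤)
    rw [add_zero] at h4
    refine tendsto_nhds_unique h1 ?_
    simpa only [fun N => transfer_mean hβ₀ hβ₁ N hy] using h4
  -- The finite mass is carried to the limit through finite sums of point values, which pass to
  -- pointwise limits directly.
  have hdy : ∀ m, ∑ k ∈ Finset.range m, G (1 - (1 / 2) ^ k) * (1 / 2) ^ k ≤ 16 := by
    intro m
    refine le_of_tendsto' (tendsto_finsetSum _ fun k _ => (hG _ ?_).mul_const _)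
      fun N => (good_mean hβ₀ hβ₁ N).sum_dyadic_le (lintegral_mean_le hβ₀ hβ₁ N) m
    have h1 : (0 : ℝ) < (1 / 2) ^ k := by positivity
    have h2 : ((1 : ℝ) / 2) ^ k ≤ 1 := pow_le_one₀ (by norm_num) (by norm_num)
    exact ⟨by linarith, by linarith⟩
  have h := hG x hx
  rwa [hGood.eq_zero_of_transfer_eq hβ₀ hβ₁ hfix (fun c hc => hGood.exists_decay hdy hc) hx] at h

/-- Compact subsets of `]-1,1[` have iterated preimages of arbitrarily small measure. -/
theorem exists_volume_survivors_lt (hβ₀ : 0 < β) (hβ₁ : β ≤ 1) {a : ℝ} (ha : a < 1)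
    {δ : ℝ≥0∞} (hδ : 0 < δ) : ∃ n, volume ((survivors β)^[n] (Icc (-a) a)) < δ := by
  have hK : Icc (-a) a ⊆ Ioo (-1 : ℝ) 1 := fun x hx => ⟨by linarith [hx.1], by linarith [hx.2]⟩
  have hlim : Tendsto (fun N => ∫⁻ x in Icc (-a) a, ENNReal.ofReal (mean β N x)) atTop
      (𝓝 (∫⁻ _ in Icc (-a) a, 0)) := by
    refine tendsto_lintegral_of_dominated_convergence' (fun x => ENNReal.ofReal (weight x))
      (fun N => ?_) (fun N => ?_) ?_ ?_
    · exact (((good_mean hβ₀ hβ₁ N).continuousOn.mono hK).aemeasurable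
        measurableSet_Icc).ennreal_ofReal
    · exact (ae_restrict_iff' measurableSet_Icc).2 (Eventually.of_forall fun x hx =>
        ENNReal.ofReal_le_ofReal ((good_mean hβ₀ hβ₁ N).le_weight x (hK hx)))
    · have hc : ContinuousOn weight (Icc (-a) a) := ContinuousOn.inv₀ (by fun_prop)
        fun x hx => (one_sub_sq_pos (hK hx)).ne'
      exact (hc.integrableOn_Icc).lintegral_lt_top.ne
    · refine (ae_restrict_iff' measurableSet_Icc).2 (Eventually.of_forall fun x hx => ?_)
      have := ENNReal.tendsto_ofReal (tendsto_mean hβ₀ hβ₁ (hK hx))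
      rwa [ENNReal.ofReal_zero] at this
  rw [lintegral_zero] at hlim
  obtain ⟨N, hN⟩ := (hlim.eventually_lt_const hδ).exists
  -- If every preimage had measure at least `δ`, so would their average, which is the integral of
  -- `mean β N`.
  by_contra! hcon
  rw [setLIntegral_mean hβ₀ hβ₁ N measurableSet_Icc hK] at hN
  refine absurd hN (not_lt.2 ?_)
  have h := Finset.card_nsmul_le_sum (Finset.range (N + 1)) _ δ fun n _ => hcon n
  rw [Finset.card_range, nsmul_eq_mul] at h
  calc δ = ENNReal.ofReal (((N : ℝ) + 1)⁻¹) * (((N + 1 : ℕ) : ℝ≥0∞) * δ) := by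
        rw [← mul_assoc, ofReal_inv_mul_cast, one_mul]
    _ ≤ _ := mul_le_mul_right h _

/-! ### Eigenvectors and conclusion. -/

/-- If `g` is an eigenvector with eigenvalue of modulus at least one, then the mass of `|g|` does
not decrease along preimages. -/
theorem setLIntegral_le_survivors {z : ℂ} (hz : 1 ≤ ‖z‖) {g : LOne} (hg : Cstar β g = z • g)
    {S : Set ℝ} (hS : MeasurableSet S) :
    ∫⁻ x in S, ‖g x‖ₑ ∂leb ≤ ∫⁻ x in survivors β S, ‖g x‖ₑ ∂leb := by
  -- The conjugate phase turns the pairing into the mass of `|g|` on `S`; where `g` vanishes,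
  -- division by zero gives 0, as wanted.
  set s : ℝ → ℂ := S.indicator fun x => (starRingEnd ℂ) (g x) / ‖g x‖ with hs
  have hm : AEStronglyMeasurable s leb := by
    have h1 : AEMeasurable (g : ℝ → ℂ) leb := (Lp.aestronglyMeasurable g).aemeasurable
    have h2 : AEMeasurable (fun x => (starRingEnd ℂ) (g x)) leb :=
      Complex.continuous_conj.measurable.comp_aemeasurable h1
    have h3 : AEMeasurable (fun x => ((‖g x‖ : ℝ) : ℂ)) leb :=
      Complex.measurable_ofReal.comp_aemeasurable h1.norm
    exact (h2.div h3).aestronglyMeasurable.indicator hS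
  have hb : ∀ x, ‖s x‖ ≤ S.indicator (fun _ => (1 : ℝ)) x := by
    intro x
    by_cases hx : x ∈ S
    · simp only [hs, indicator_of_mem hx, norm_div, RCLike.norm_conj, Complex.norm_real, norm_norm]
      exact div_self_le_one _
    · simp [hs, indicator_of_notMem hx]
  have hL : MemLp s ∞ leb := memLp_top_of_bound hm 1 (Eventually.of_forall fun x =>
    (hb x).trans (indicator_le_self' (fun _ _ => zero_le_one) x))
  set f : LInf := hL.toLp s
  have hfs : f =ᵐ[leb] s := hL.coeFn_toLp
  have hgi := (integrable_coe g).norm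
  have e1 : pairing g f = ((∫ x in S, ‖g x‖ ∂leb : ℝ) : ℂ) := by
    unfold pairing
    rw [← integral_indicator hS, ← integral_complex_ofReal]
    refine integral_congr_ae ?_
    filter_upwards [hfs] with x hx
    rw [hx]
    by_cases hxS : x ∈ S
    · simp only [hs, indicator_of_mem hxS]
      by_cases h0 : g x = 0
      · simp [h0]
      · have hn : ((‖g x‖ : ℝ) : ℂ) ≠ 0 := by simpa using h0
        rw [div_mul_eq_mul_div, div_eq_iff hn, Complex.conj_mul', sq]
    · simp [hs, indicator_of_notMem hxS]
  have e2 : ‖pairing g (C β f)‖ ≤ ∫ x in survivors β S, ‖g x‖ ∂leb := by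
    unfold pairing
    rw [← integral_indicator (measurableSet_survivors β hS)]
    refine norm_integral_le_of_norm_le (hgi.indicator (measurableSet_survivors β hS)) ?_
    filter_upwards [C_coeFn β f, ae_comp β hfs] with x hx hx'
    rw [hx, compFun, norm_mul]
    by_cases hm : x ∈ Ioc (-β) β
    · rw [indicator_of_mem hm, hx' hm]
      by_cases hU : U β x ∈ S
      · rw [indicator_of_mem (show x ∈ survivors β S from ⟨hm, hU⟩)]
        have h := hb (U β x)
        rw [indicator_of_mem hU] at h
        exact mul_le_of_le_one_left (norm_nonneg _) h
      · simp only [hs, indicator_of_notMem hU, norm_zero, zero_mul]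
        exact indicator_nonneg (fun _ _ => norm_nonneg _) x
    · simp only [indicator_of_notMem hm, norm_zero, zero_mul]
      exact indicator_nonneg (fun _ _ => norm_nonneg _) x
  have e3 : z * pairing g f = pairing g (C β f) := by
    rw [← pairing_smul, ← hg, Cstar_spec β g f]
  have hnn : 0 ≤ ∫ x in S, ‖g x‖ ∂leb := integral_nonneg fun _ => norm_nonneg _
  have e4 : ∫ x in S, ‖g x‖ ∂leb ≤ ∫ x in survivors β S, ‖g x‖ ∂leb := by
    rw [← e3, norm_mul, e1, Complex.norm_real, Real.norm_of_nonneg hnn] at e2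
    exact (le_mul_of_one_le_left hnn hz).trans e2
  have h := ENNReal.ofReal_le_ofReal e4
  rwa [ofReal_integral_norm_eq_lintegral_enorm (integrable_coe g).restrict,
    ofReal_integral_norm_eq_lintegral_enorm (integrable_coe g).restrict] at h

theorem eq_zero_of_eigenvector (hβ₀ : 0 < β) (hβ₁ : β ≤ 1) {z : ℂ} (hz : 1 ≤ ‖z‖) {g : LOne}
    (hg : Cstar β g = z • g) : g = 0 := by
  have hfin : ∫⁻ x, ‖g x‖ₑ ∂leb ≠ ∞ := (integrable_coe g).2.ne
  have hK : ∀ a : ℝ, a < 1 → ∫⁻ x in Icc (-a) a, ‖g x‖ₑ ∂leb = 0 := by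
    intro a ha
    by_contra hne
    -- By absolute continuity, sets of measure below `δ` carry less mass of `|g|` than the compact
    -- set, yet some iterated preimage is that small and carries at least as much.
    obtain ⟨δ, hδ, H⟩ := exists_pos_setLIntegral_lt_of_measure_lt hfin hne
    obtain ⟨n, hn⟩ := exists_volume_survivors_lt hβ₀ hβ₁ ha hδ
    have hsub : Icc (-a) a ⊆ Ioc (-1 : ℝ) 1 := fun x hx =>
      ⟨by linarith [hx.1], by linarith [hx.2]⟩
    have hle : ∀ n, ∫⁻ x in Icc (-a) a, ‖g x‖ₑ ∂leb
        ≤ ∫⁻ x in (survivors β)^[n] (Icc (-a) a), ‖g x‖ₑ ∂leb := by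
      intro n
      induction n with
      | zero => exact le_rfl
      | succ n ih =>
        rw [Function.iterate_succ_apply']
        exact ih.trans (setLIntegral_le_survivors hz hg
          (iterate_survivors hβ₁ measurableSet_Icc hsub n).1)
    exact lt_irrefl _ ((hle n).trans_lt (H _ ((Measure.restrict_apply_le _ _).trans_lt hn)))
  have hae : ∀ m : ℕ, ∀ᵐ x ∂leb, x ∈ Icc (-(1 - 1 / ((m : ℝ) + 1))) (1 - 1 / ((m : ℝ) + 1)) →
      g x = 0 := by
    intro m
    have h := hK (1 - 1 / ((m : ℝ) + 1)) (by
      have : 0 < 1 / ((m : ℝ) + 1) := by positivity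
      linarith)
    rw [lintegral_eq_zero_iff' (Lp.aestronglyMeasurable g).restrict.enorm] at h
    filter_upwards [(ae_restrict_iff' measurableSet_Icc).1 h] with x hx hxm
    simpa using hx hxm
  have hIoo : ∀ᵐ x ∂leb, x ∈ Ioo (-1 : ℝ) 1 := by
    rw [leb, ← restrict_Ioo_eq_restrict_Ioc]
    exact ae_restrict_mem measurableSet_Ioo
  rw [Lp.eq_zero_iff_ae_eq_zero]
  filter_upwards [ae_all_iff.2 hae, hIoo] with x hx hx1
  have hpos : 0 < 1 - |x| := sub_pos.2 (abs_lt.2 hx1)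
  obtain ⟨m, hm⟩ := exists_nat_one_div_lt hpos
  exact hx m (abs_le.1 (by linarith))

end

end GaussType

end

theorem mainTheorem5 (β : ℝ) (hβ₀ : 0 < β) (hβ₁ : β ≤ 1) :
    GaussType.pointSpectrum (GaussType.Cstar β) ⊆ Metric.ball (0 : ℂ) 1 ∧
      (1 : ℂ) ∉ GaussType.pointSpectrum (GaussType.Cstar β) ∧
      (-1 : ℂ) ∉ GaussType.pointSpectrum (GaussType.Cstar β) := by
  have key : GaussType.pointSpectrum (GaussType.Cstar β) ⊆ Metric.ball (0 : ℂ) 1 := by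
    intro z hz
    obtain ⟨g, hg⟩ := Module.End.HasEigenvalue.exists_hasEigenvector hz
    rw [mem_ball_zero_iff]
    by_contra h
    exact hg.2 (GaussType.eq_zero_of_eigenvector hβ₀ hβ₁ (not_lt.1 h) hg.apply_eq_smul)
  refine ⟨key, fun h => ?_, fun h => ?_⟩
  · simpa using key h
  · simpa using key h
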